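/- All number fields are subfields of a fixed algebraic closure $\overline{\mathbb Q}$, and Artin representations (over ${\mathbb Q}$) are finite-dimensional complex representations of ${\rm Gal}(\overline{\mathbb Q}/{\mathbb Q})$ that factor through ${\rm Gal}(K/{\mathbb Q})$ for some finite Galois extension $K/{\mathbb Q}$, taken up to isomorphism. For an elliptic curve $E/{\mathbb Q}$ and a number field $K$ put $$ {\rm BSD}(E/K)=\frac{{\rm Reg}_{E/K}\cdot|{\rm Sha}_{E/K}|\cdot C_{E/K}}{|E(K)_{\rm tors}|^2},\qquad C_{E/K}=\prod_{v\nmid\infty}c_v(E/K)\left|\frac{\omega}{\omega_v^{\min}}\right|_v, $$ where ${\rm Reg}_{E/K}$ is the regulator of the N\'eron--Tate pairing over $K$, $c_v$ are the Tamagawa numbers, $\omega$ is a global minimal differential of $E/{\mathbb Q}$ and $\omega_v^{\min}$ a minimal differential of $E/K_v$. For a representation $\rho$ let ${\mathbb Q}(\rho)$ be the field generated by the values of its character, for ${\mathfrak g}\in{\rm Gal}({\mathbb Q}(\rho)/{\mathbb Q})$ let $\rho^{\mathfrak g}$ be the representation with character ${\mathfrak g}\circ{\rm Tr}\,\rho$,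 let ${\mathfrak f}_\rho$ be the Artin conductor of $\rho$ and ${\mathfrak f}_E$ the conductor of $E$. Write $E(K)_{\mathbb C}=E(K)\otimes_{\mathbb Z}{\mathbb C}$ and $\langle\cdot,\cdot\rangle$ for the inner product of characters. For an elliptic curve $E/{\mathbb Q}$ consider the following properties of a function that assigns to every (isomorphism class of an) Artin representation $\rho$ a number ${\rm BSD}(E,\rho)\in{\mathbb C}^\times$: * (C1) for every number field $K$, ${\rm Sha}_{E/K}$ is finite and ${\rm BSD}(E/K)={\rm BSD}(E,{\rm Ind}_{K/{\mathbb Q}}{\mathbf 1})$; * (C2) ${\rm BSD}(E,\rho\oplus\tau)={\rm BSD}(E,\rho)\,{\rm BSD}(E,\tau)$ for all $\rho,\tau$; * (C5) if $\rho$ factors through ${\rm Gal}(K/{\mathbb Q})$ with $K/{\mathbb Q}$ finite Galois and $\langle\rho,E(K)_{\mathbb C}\rangle=0$, then ${\rm BSD}(E,\rho)\in{\mathbb Q}(\rho)^\times$ and ${\rm BSD}(E,\rho^{\mathfrak g})={\rm BSD}(E,\rho)^{\mathfrak g}$ for all ${\mathfrak g}\in{\rm Gal}({\mathbb Q}(\rho)/{\mathbb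 Q})$; * (C6) if $\rho$ factors through ${\rm Gal}(K/{\mathbb Q})$ with $K/{\mathbb Q}$ finite Galois, $\langle\rho,E(K)_{\mathbb C}\rangle=0$, $\rho$ is a non-trivial one-dimensional Artin representation (that is, a non-trivial primitive Dirichlet character) of order $n$, and either ${\mathfrak f}_E$ and ${\mathfrak f}_\rho$ are coprime or $E$ is semistable and has no non-trivial isogenies over ${\mathbb Q}$, then ${\rm BSD}(E,\rho)\in{\mathbb Z}[\zeta_n]$. **Theorem.** Let $G$ be a finite group and $\rho$ an irreducible complex representation of $G$. Suppose that, as virtual representations of $G$, $$ \Big(\bigoplus_{{\mathfrak g}\in{\rm Gal}({\mathbb Q}(\rho)/{\mathbb Q})}\rho^{\mathfrak g}\Big)^{\oplus m}=\Big(\bigoplus_i{\rm Ind}_{H_i}^G{\mathbf 1}\Big)\ominus\Big(\bigoplus_j{\rm Ind}_{H_j'}^G{\mathbf 1}\Big) $$ for some $m\in{\mathbb Z}$ and finite families of subgroups $H_i,H_j'\le G$. Let $E/{\mathbb Q}$ be an elliptic curve and $F/{\mathbb Q}$ a Galois extension with Galois group $G$. 1. If there are invariants ${\rm BSD}(E,\cdot)$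 satisfying (C1), (C2) and (C5), then either $\langle\rho,E(F)_{\mathbb C}\rangle>0$ or $$ \frac{\prod_i{\rm BSD}(E/F^{H_i})}{\prod_j{\rm BSD}(E/F^{H_j'})}=N_{{\mathbb Q}(\rho)/{\mathbb Q}}(x)^m\qquad\text{for some }x\in{\mathbb Q}(\rho). $$ 2. Suppose there are invariants ${\rm BSD}(E,\cdot)$ satisfying (C1), (C2), (C5) and (C6), $\rho$ is non-trivial and $G$ is abelian of exponent $d$. If ${\mathfrak f}_E$ and ${\mathfrak f}_\rho$ are coprime (with $\rho$ regarded as an Artin representation through $G={\rm Gal}(F/{\mathbb Q})$), or if $E$ is semistable and has no non-trivial isogenies over ${\mathbb Q}$, then in the second alternative of part 1 one can take $x\in{\mathbb Q}(\rho)\cap{\mathbb Z}[\zeta_d]$. -/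

import Mathlib

open scoped ComplexOrder

-- For subfields of a fixed field, prefer the structural `ℚ`-algebra instances.
attribute [instance 2000] AlgebraicClosure.instAlgebra IntermediateField.algebra'

noncomputable section

namespace BSDTwist

open NumberField IsDedekindDomain Filter TensorProduct
open scoped Classical

/-! ### Local invariants at a finite place -/

section Local

variable (R : Type*) [CommRing R] [IsDomain R] [IsDiscreteValuationRing R]
  {L : Type*} [Field L] [Algebra R L] [IsFractionRing R L]

/-- The points of a minimal Weierstrass equation `W` over `L = Frac R` whose reduction is a
nonsingular point of the reduced curve. A point with non-integral `x`-coordinate reduces to the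
point at infinity. -/
def nonsingularReduction (W : WeierstrassCurve L) [W.IsMinimal R] : Set W.toAffine.Point :=
  {P | ∀ (x y : L) (h : W.toAffine.Nonsingular x y), P = .some x y h →
    (∀ a : R, algebraMap R L a ≠ x) ∨
    ∃ a b : R, algebraMap R L a = x ∧ algebraMap R L b = y ∧
      (W.reduction R).toAffine.Nonsingular (IsLocalRing.residue R a) (IsLocalRing.residue R b)}

/-- The local Tamagawa number `[E(L) : E₀(L)]`. The set of points with nonsingular reduction is
already a subgroup, so that taking its closure does not change it. -/
def tamagawa (W : WeierstrassCurve L) : ℕ :=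
  (AddSubgroup.closure (nonsingularReduction R (W.minimal R))).index

/-- The scaling `u` of a change of variables from `W` to a minimal equation over `R`. The
invariant differentials satisfy `ω_min = u ω`. -/
def minimalScaling (W : WeierstrassCurve L) : L :=
  ((W.exists_isMinimal R).choose.u : L)

end Local

/-! ### Elliptic curves over number fields -/

section Global

variable {K : Type*} [Field K]

/-- The naive logarithmic height of the `x`-coordinate, relative to `K` (not divided by the
degree of `K`). -/
def naiveHeight [NumberField K] (W : WeierstrassCurve K) : W.toAffine.Point → ℝ
  | .zero => 0
  | .some x _ _ => Height.logHeight₁ x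

/-- The quadratic form `P ↦ ⟨P, P⟩` of the Néron--Tate pairing over `K`, that is
`lim 4⁻ⁿ h(x(2ⁿP))`. -/
def heightForm [NumberField K] (W : WeierstrassCurve K) (P : W.toAffine.Point) : ℝ :=
  limUnder atTop fun n : ℕ => naiveHeight W ((2 ^ n : ℕ) • P) / 4 ^ n

/-- The Néron--Tate height pairing over `K`. -/
def heightPairing [NumberField K] (W : WeierstrassCurve K) (P Q : W.toAffine.Point) : ℝ :=
  (heightForm W (P + Q) - heightForm W P - heightForm W Q) / 2

/-- `P₁, …, Pₙ` is a basis of the Mordell--Weil group modulo torsion. -/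
def IsMordellWeilBasis (W : WeierstrassCurve K) {n : ℕ} (P : Fin n → W.toAffine.Point) : Prop :=
  LinearIndependent ℤ P ∧
    AddSubgroup.closure (Set.range P) ⊔ AddCommGroup.torsion W.toAffine.Point = ⊤

/-- The regulator: the absolute value of the determinant of the height pairing on a basis of the
Mordell--Weil group modulo torsion. -/
def regulator [NumberField K] (W : WeierstrassCurve K) : ℝ :=
  if h : ∃ (n : ℕ) (P : Fin n → W.toAffine.Point), IsMordellWeilBasis W P then
    |(Matrix.of fun i j => heightPairing W (h.choose_spec.choose i)
      (h.choose_spec.choose j)).det|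
  else 0

/-- The group of points over an algebraic closure. -/
abbrev GeomPoint (W : WeierstrassCurve K) (L : Type*) [Field L] [Algebra K L] : Type _ :=
  (W.baseChange (AlgebraicClosure L)).toAffine.Point

/-- The Galois action on points. -/
abbrev galPoint (W : WeierstrassCurve K) {S L : Type*} [Field S] [Field L] [Algebra K S]
    [Algebra S L] [Algebra K L] [IsScalarTower K S L] (σ : L ≃ₐ[S] L) :
    (W.baseChange L).toAffine.Point →+ (W.baseChange L).toAffine.Point :=
  WeierstrassCurve.Affine.Point.map (W' := W) (σ : L →ₐ[S] L)

/-- A cochain on `G_K` with values in `E(K̄)` becomes a coboundary over the extension `L` of `K`: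
for every embedding of algebraic closures over `K`, its restriction to `G_L` is
`σ ↦ σQ - Q` for some point `Q` over the algebraic closure of `L`. -/
def IsTrivialOver (W : WeierstrassCurve K) (L : Type*) [Field L] [Algebra K L]
    (f : (AlgebraicClosure K ≃ₐ[K] AlgebraicClosure K) → GeomPoint W K) : Prop :=
  ∀ j : AlgebraicClosure K →ₐ[K] AlgebraicClosure L, ∃ Q : GeomPoint W L,
    ∀ (σ : AlgebraicClosure L ≃ₐ[L] AlgebraicClosure L)
      (τ : AlgebraicClosure K ≃ₐ[K] AlgebraicClosure K), (∀ x, j (τ x) = σ (j x)) →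
      WeierstrassCurve.Affine.Point.map (W' := W) j (f τ) = galPoint W σ Q - Q

/-- Continuous `1`-cocycles of `G_K` in `E(K̄)` that are locally trivial at all places. -/
def shaCocycles [NumberField K] (W : WeierstrassCurve K) :
    AddSubgroup ((AlgebraicClosure K ≃ₐ[K] AlgebraicClosure K) → GeomPoint W K) where
  carrier := {f | IsLocallyConstant f ∧ (∀ σ τ, f (σ * τ) = f σ + galPoint W σ (f τ)) ∧
    (∀ v : HeightOneSpectrum (𝓞 K), IsTrivialOver W (v.adicCompletion K) f) ∧
    ∀ v : InfinitePlace K, IsTrivialOver W v.Completion f}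
  zero_mem' := by
    have h0 : ∀ (L : Type _) [Field L] [Algebra K L], IsTrivialOver W L
        (0 : (AlgebraicClosure K ≃ₐ[K] AlgebraicClosure K) → GeomPoint W K) :=
      fun L _ _ j => ⟨0, fun σ τ _ => by simp⟩
    exact ⟨IsLocallyConstant.const 0, fun σ τ => by simp, fun v => h0 _, fun v => h0 _⟩
  add_mem' := by
    rintro f g ⟨hf, hf1, hf2, hf3⟩ ⟨hg, hg1, hg2, hg3⟩
    have h : ∀ (L : Type _) [Field L] [Algebra K L], IsTrivialOver W L f →
        IsTrivialOver W L g → IsTrivialOver W L (f + g) := by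
      intro L _ _ h1 h2 j
      obtain ⟨Q, hQ⟩ := h1 j
      obtain ⟨Q', hQ'⟩ := h2 j
      refine ⟨Q + Q', fun σ τ hστ => ?_⟩
      rw [Pi.add_apply, map_add, map_add, hQ σ τ hστ, hQ' σ τ hστ]
      abel
    refine ⟨hf.add hg, fun σ τ => ?_, fun v => h _ (hf2 v) (hg2 v), fun v => h _ (hf3 v) (hg3 v)⟩
    simp only [Pi.add_apply, hf1, hg1, map_add]
    abel
  neg_mem' := by
    rintro f ⟨hf, hf1, hf2, hf3⟩
    have h : ∀ (L : Type _) [Field L] [Algebra K L], IsTrivialOver W L f →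
        IsTrivialOver W L (-f) := by
      intro L _ _ h1 j
      obtain ⟨Q, hQ⟩ := h1 j
      refine ⟨-Q, fun σ τ hστ => ?_⟩
      rw [Pi.neg_apply, map_neg, map_neg, hQ σ τ hστ]
      abel
    refine ⟨hf.neg, fun σ τ => ?_, fun v => h _ (hf2 v), fun v => h _ (hf3 v)⟩
    simp only [Pi.neg_apply, hf1, map_neg]
    abel

/-- The `1`-coboundaries `σ ↦ σP - P`. -/
def coboundaries (W : WeierstrassCurve K) :
    AddSubgroup ((AlgebraicClosure K ≃ₐ[K] AlgebraicClosure K) → GeomPoint W K) where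
  carrier := {f | ∃ P : GeomPoint W K, ∀ σ, f σ = galPoint W σ P - P}
  zero_mem' := ⟨0, fun σ => by simp⟩
  add_mem' := by
    rintro f g ⟨P, hP⟩ ⟨Q, hQ⟩
    refine ⟨P + Q, fun σ => ?_⟩
    rw [Pi.add_apply, map_add, hP, hQ]
    abel
  neg_mem' := by
    rintro f ⟨P, hP⟩
    refine ⟨-P, fun σ => ?_⟩
    rw [Pi.neg_apply, map_neg, hP]
    abel

/-- The Tate--Shafarevich group `ker (H¹(K, E) → ∏ᵥ H¹(Kᵥ, E))`. -/
abbrev Sha [NumberField K] (W : WeierstrassCurve K) : Type _ :=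
  shaCocycles W ⧸ (coboundaries W).addSubgroupOf (shaCocycles W)

end Global

/-! ### The quotient `BSD(E/K)` for `E/ℚ` -/

section BSD

variable (E : WeierstrassCurve ℚ)

/-- A Weierstrass equation over `ℚ` that is minimal at every prime. -/
def IsGloballyMinimal : Prop :=
  ∀ (p : ℕ) [Fact p.Prime], (E.baseChange ℚ_[p]).IsMinimal ℤ_[p]

/-- A globally minimal equation of `E`. -/
def globalMinimal : WeierstrassCurve ℚ :=
  if h : ∃ C : WeierstrassCurve.VariableChange ℚ, IsGloballyMinimal (C • E) then h.choose • E else E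

variable (K : Type*) [Field K] [NumberField K]

/-- The factor `c_v(E/K) |ω / ω_v^min|_v`, where `ω` is the invariant differential of a globally
minimal equation of `E` over `ℚ` and `|·|_v` is the normalised absolute value. -/
def localFactor (v : HeightOneSpectrum (𝓞 K)) : ℝ :=
  tamagawa (v.adicCompletionIntegers K) ((E.baseChange K).baseChange (v.adicCompletion K)) *
  ‖minimalScaling (v.adicCompletionIntegers K)
      (((globalMinimal E).baseChange K).baseChange (v.adicCompletion K))‖⁻¹

/-- `BSD(E/K) = Reg(E/K) |Ш(E/K)| C(E/K) / |E(K)_tors|²`. -/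
def BSDQuotient : ℝ :=
  regulator (E.baseChange K) * Nat.card (Sha (E.baseChange K)) *
    (∏ᶠ v : HeightOneSpectrum (𝓞 K), localFactor E K v) /
    (Nat.card (AddCommGroup.torsion (E.baseChange K).toAffine.Point) : ℝ) ^ 2

end BSD

/-! ### Characters -/

section Characters

variable {G : Type*} [Group G] {V : Type*} [AddCommGroup V] [Module ℂ V]

/-- The field `ℚ(ρ)` generated by the values of the character of `ρ`. -/
abbrev charField (ρ : Representation ℂ G V) : IntermediateField ℚ ℂ :=
  IntermediateField.adjoin ℚ (Set.range ρ.character)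

/-- The character value `Tr ρ(g)` as an element of `ℚ(ρ)`. -/
def charValue (ρ : Representation ℂ G V) (g : G) : charField ρ :=
  ⟨ρ.character g, IntermediateField.subset_adjoin _ _ ⟨g, rfl⟩⟩

/-- The usual inner product `⟨χ, ψ⟩ = |G|⁻¹ ∑ χ(g) ψ(g⁻¹)` of characters. -/
def charInner [Fintype G] (χ ψ : G → ℂ) : ℂ :=
  (Fintype.card G : ℂ)⁻¹ * ∑ g, χ g * ψ g⁻¹

/-- The representation `Ind_H^G 1`, realised as the permutation representation on `G / H`. -/
abbrev indOne (H : Subgroup G) : Representation ℂ G (MonoidAlgebra ℂ (G ⧸ H)) :=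
  Representation.ofMulAction ℂ G (G ⧸ H)

/-- The ring `ℤ[ζ_d]` inside `ℂ`. -/
def cyclotomicInt (d : ℕ) : Subalgebra ℤ ℂ :=
  Algebra.adjoin ℤ {Complex.exp (2 * Real.pi * Complex.I / d)}

end Characters

/-! ### Artin representations over `ℚ` -/

/-- The fixed algebraic closure of `ℚ`. -/
abbrev Qbar : Type := AlgebraicClosure ℚ

/-- The absolute Galois group of `ℚ`. -/
abbrev GQ : Type := Qbar ≃ₐ[ℚ] Qbar

/-- An Artin representation over `ℚ`: a finite-dimensional complex representation of `G_ℚ` that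
factors through `Gal(K/ℚ)` for a finite Galois extension `K/ℚ`. -/
structure ArtinRep where
  /-- The underlying complex vector space. -/
  V : Type
  [addCommGroup : AddCommGroup V]
  [module : Module ℂ V]
  [finiteDimensional : FiniteDimensional ℂ V]
  /-- The action of the absolute Galois group. -/
  ρ : Representation ℂ GQ V
  factors : ∃ K : IntermediateField ℚ Qbar, FiniteDimensional ℚ K ∧ IsGalois ℚ K ∧
    ∀ σ ∈ K.fixingSubgroup, ρ σ = 1

attribute [instance] ArtinRep.addCommGroup ArtinRep.module ArtinRep.finiteDimensional

namespace ArtinRep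

/-- The Artin representation defined by a representation of `Gal(K/ℚ)`. -/
def inflate (K : IntermediateField ℚ Qbar) [FiniteDimensional ℚ K] [IsGalois ℚ K] {V : Type}
    [AddCommGroup V] [Module ℂ V] [FiniteDimensional ℂ V] (ρ : Representation ℂ (K ≃ₐ[ℚ] K) V) :
    ArtinRep where
  V := V
  ρ := ρ.comp (AlgEquiv.restrictNormalHom K)
  factors := by
    refine ⟨K, inferInstance, inferInstance, fun σ hσ => ?_⟩
    rw [← IntermediateField.restrictNormalHom_ker] at hσ
    rw [MonoidHom.comp_apply, MonoidHom.mem_ker.mp hσ, map_one]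

/-- The direct sum of two Artin representations. -/
def sum (ρ τ : ArtinRep) : ArtinRep where
  V := ρ.V × τ.V
  ρ := ρ.ρ.prod τ.ρ
  factors := by
    obtain ⟨K, hK, hK', h⟩ := ρ.factors
    obtain ⟨L, hL, hL', h'⟩ := τ.factors
    refine ⟨K ⊔ L, inferInstance, inferInstance, fun σ hσ => ?_⟩
    have h1 := h σ (IntermediateField.fixingSubgroup_antitone le_sup_left hσ)
    have h2 := h' σ (IntermediateField.fixingSubgroup_antitone le_sup_right hσ)
    ext x <;> simp [h1, h2]

instance finite_quotient (K : IntermediateField ℚ Qbar) [FiniteDimensional ℚ K] :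
    Finite (GQ ⧸ K.fixingSubgroup) :=
  Subgroup.quotient_finite_of_isOpen _ K.fixingSubgroup_isOpen

/-- The representation `Ind_{K/ℚ} 1` for a number field `K`. -/
def ind (K : IntermediateField ℚ Qbar) [FiniteDimensional ℚ K] : ArtinRep where
  V := MonoidAlgebra ℂ (GQ ⧸ K.fixingSubgroup)
  finiteDimensional := Module.Finite.equiv (MonoidAlgebra.coeffLinearEquiv ℂ).symm
  ρ := indOne K.fixingSubgroup
  factors := by
    refine ⟨IntermediateField.normalClosure ℚ K Qbar, inferInstance, ⟨⟩, fun σ hσ => ?_⟩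
    have h : ∀ q : GQ ⧸ K.fixingSubgroup, σ • q = q := by
      intro q
      induction q using QuotientGroup.induction_on with
      | H g =>
        rw [MulAction.Quotient.smul_coe, eq_comm, QuotientGroup.eq, smul_eq_mul,
          IntermediateField.mem_fixingSubgroup_iff]
        intro x hx
        have hgx : g x ∈ IntermediateField.normalClosure ℚ K Qbar := by
          have := ((g : Qbar →ₐ[ℚ] Qbar).comp K.val).fieldRange_le_normalClosure
          exact this ⟨⟨x, hx⟩, rfl⟩
        have := (IntermediateField.mem_fixingSubgroup_iff _ _).mp hσ _ hgx
        simp only [AlgEquiv.mul_apply, this]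
        exact g.symm_apply_apply x
    ext q
    simp [h]

end ArtinRep

/-- The action of an automorphism of `L` on `E(L)`, as a `ℤ`-linear map. -/
def galLin (E : WeierstrassCurve ℚ) {L : Type*} [Field L] [Algebra ℚ L] (σ : L ≃ₐ[ℚ] L) :
    (E.baseChange L).toAffine.Point →ₗ[ℤ] (E.baseChange L).toAffine.Point where
  toFun := galPoint E σ
  map_add' := map_add (galPoint E σ)
  map_smul' n P := map_zsmul (galPoint E σ) n P

theorem galLin_one (E : WeierstrassCurve ℚ) {L : Type*} [Field L] [Algebra ℚ L] :
    galLin E (1 : L ≃ₐ[ℚ] L) = LinearMap.id := by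
  refine LinearMap.ext fun P => ?_
  cases P <;> rfl

theorem galLin_mul (E : WeierstrassCurve ℚ) {L : Type*} [Field L] [Algebra ℚ L]
    (σ τ : L ≃ₐ[ℚ] L) : galLin E (σ * τ) = galLin E σ ∘ₗ galLin E τ := by
  refine LinearMap.ext fun P => ?_
  cases P <;> rfl

/-- The representation of `Gal(L/ℚ)` on `E(L) ⊗ ℂ`. -/
def mordellWeil (E : WeierstrassCurve ℚ) (L : Type*) [Field L] [Algebra ℚ L] :
    Representation ℂ (L ≃ₐ[ℚ] L) (ℂ ⊗[ℤ] (E.baseChange L).toAffine.Point) where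
  toFun σ := LinearMap.baseChange ℂ (galLin E σ)
  map_one' := by rw [galLin_one, LinearMap.baseChange_id]; rfl
  map_mul' σ τ := by rw [galLin_mul, LinearMap.baseChange_comp]; rfl

/-- The multiplicity `⟨ρ, E(K)_ℂ⟩`. -/
def multiplicity (E : WeierstrassCurve ℚ) (K : IntermediateField ℚ Qbar) [FiniteDimensional ℚ K]
    {V : Type*} [AddCommGroup V] [Module ℂ V] (ρ : Representation ℂ (K ≃ₐ[ℚ] K) V) : ℂ :=
  charInner ρ.character (mordellWeil E K).character

/-! ### Conductors -/

section Conductors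

/-- A prime of `K` above `p`. -/
def primeAbove (K : IntermediateField ℚ Qbar) (p : ℕ) : Ideal (𝓞 K) :=
  Classical.epsilon fun P => P.IsPrime ∧ (p : 𝓞 K) ∈ P

/-- The `i`-th ramification group (in the lower numbering) at a prime of `K` above `p`:
those `σ` with `σ x ≡ x mod P^(i+1)` for all integers `x` of `K`. -/
def ramificationGroup (K : IntermediateField ℚ Qbar) (p i : ℕ) : Subgroup (K ≃ₐ[ℚ] K) :=
  (Submodule.toAddSubgroup (primeAbove K p ^ (i + 1))).inertia (K ≃ₐ[ℚ] K)

variable {V : Type*} [AddCommGroup V] [Module ℂ V]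

/-- The exponent of `p` in the Artin conductor,
`∑_{i ≥ 0} |G_i| / |G_0| · codim V^{G_i}`; the division is exact. -/
def artinExponent (K : IntermediateField ℚ Qbar) (ρ : Representation ℂ (K ≃ₐ[ℚ] K) V) (p : ℕ) : ℕ :=
  (∑ᶠ i : ℕ, Nat.card (ramificationGroup K p i) *
    (Module.finrank ℂ V - Module.finrank ℂ
      (Representation.invariants (ρ.comp (ramificationGroup K p i).subtype)))) /
    Nat.card (ramificationGroup K p 0)

/-- The Artin conductor of a representation of `Gal(K/ℚ)`. -/
def artinConductor (K : IntermediateField ℚ Qbar) (ρ : Representation ℂ (K ≃ₐ[ℚ] K) V) : ℕ :=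
  ∏ᶠ p : Nat.Primes, (p : ℕ) ^ artinExponent K ρ p

variable (E : WeierstrassCurve ℚ)

/-- The field `ℚ(E[ℓ])`. -/
def torsionField (l : ℕ) : IntermediateField ℚ Qbar :=
  IntermediateField.adjoin ℚ {a | ∃ (x y : Qbar) (h : (E.baseChange Qbar).toAffine.Nonsingular x y),
    l • WeierstrassCurve.Affine.Point.some x y h = 0 ∧ (a = x ∨ a = y)}

/-- The dimension over `𝔽_ℓ` of the part of `E[ℓ]` fixed by the `i`-th ramification group of
`ℚ(E[ℓ])` at `p`. -/
def fixedTorsionDim (l p i : ℕ) : ℕ :=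
  Nat.log l (Nat.card {P : (E.baseChange (torsionField E l)).toAffine.Point //
    l • P = 0 ∧ ∀ σ ∈ ramificationGroup (torsionField E l) p i, galPoint E σ P = P})

/-- The wild part `∑_{i ≥ 1} |G_i| / |G_0| · dim E[ℓ] / E[ℓ]^{G_i}` of the conductor exponent,
computed in `ℚ(E[ℓ])` with a prime `ℓ ≠ p`; the division is exact. -/
def wildExponent (p : ℕ) : ℕ :=
  let l := if p = 3 then 5 else 3
  (∑ᶠ i : ℕ, Nat.card (ramificationGroup (torsionField E l) p (i + 1)) *
    (2 - fixedTorsionDim E l p (i + 1))) / Nat.card (ramificationGroup (torsionField E l) p 0)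

/-- `E` has good reduction at `p`. -/
def GoodAt (p : ℕ) [Fact p.Prime] : Prop :=
  ((E.baseChange ℚ_[p]).minimal ℤ_[p]).HasGoodReduction ℤ_[p]

/-- `E` has multiplicative reduction at `p`. -/
def MultiplicativeAt (p : ℕ) [Fact p.Prime] : Prop :=
  ((E.baseChange ℚ_[p]).minimal ℤ_[p]).HasMultiplicativeReduction ℤ_[p]

/-- The exponent of `p` in the conductor of `E`. -/
def conductorExponent (p : ℕ) [Fact p.Prime] : ℕ :=
  (if GoodAt E p then 0 else if MultiplicativeAt E p then 1 else 2) + wildExponent E p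

/-- The conductor of `E`. -/
def conductor : ℕ :=
  ∏ᶠ p : Nat.Primes, (p : ℕ) ^ (haveI : Fact (p : ℕ).Prime := ⟨p.2⟩; conductorExponent E p)

/-- `E` is semistable: it has good or multiplicative reduction at every prime. -/
def IsSemistable : Prop := ∀ (p : ℕ) [Fact p.Prime], GoodAt E p ∨ MultiplicativeAt E p

/-- A group homomorphism `E(ℚ̄) → E'(ℚ̄)` is an isogeny over `ℚ`: it is non-zero and, off a finite
set of points, given by rational functions `(f / h, g / h)` with rational coefficients. -/
def IsIsogeny (E' : WeierstrassCurve ℚ)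
    (φ : (E.baseChange Qbar).toAffine.Point →+ (E'.baseChange Qbar).toAffine.Point) : Prop :=
  φ ≠ 0 ∧ ∃ f g h : MvPolynomial (Fin 2) ℚ,
    {P | ¬ ∃ (x y : Qbar) (hP : (E.baseChange Qbar).toAffine.Nonsingular x y)
      (hQ : (E'.baseChange Qbar).toAffine.Nonsingular
        (MvPolynomial.aeval ![x, y] f / MvPolynomial.aeval ![x, y] h)
        (MvPolynomial.aeval ![x, y] g / MvPolynomial.aeval ![x, y] h)),
      MvPolynomial.aeval ![x, y] h ≠ 0 ∧ P = .some x y hP ∧ φ P = .some _ _ hQ}.Finite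

/-- `E` has no non-trivial isogenies over `ℚ`: every isogeny from `E` over `ℚ` has the kernel
`E[n]` of a multiplication map, that is, it is `[n]` followed by an isomorphism. -/
def HasNoNontrivialIsogenies : Prop :=
  ∀ (E' : WeierstrassCurve ℚ) [E'.IsElliptic]
    (φ : (E.baseChange Qbar).toAffine.Point →+ (E'.baseChange Qbar).toAffine.Point),
    IsIsogeny E E' φ → ∃ n : ℕ, n ≠ 0 ∧ ∀ P, φ P = 0 ↔ n • P = 0

/-- The condition on `E` and `ρ` under which integrality is predicted. -/
def IntegralityCondition (K : IntermediateField ℚ Qbar) (ρ : Representation ℂ (K ≃ₐ[ℚ] K) V) :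
    Prop :=
  Nat.Coprime (conductor E) (artinConductor K ρ) ∨ (IsSemistable E ∧ HasNoNontrivialIsogenies E)

end Conductors

/-! ### The conjecture on the invariants `BSD(E, ρ)` -/

section Conjecture

instance numberField (K : IntermediateField ℚ Qbar) [h : FiniteDimensional ℚ K] : NumberField K where
  to_finiteDimensional := by
    convert h

variable (E : WeierstrassCurve ℚ) (B : ArtinRep → ℂˣ)

/-- `B` depends only on the isomorphism class of the representation. -/
def IsoInvariant : Prop :=
  ∀ ρ τ : ArtinRep, Nonempty (ρ.ρ.Equiv τ.ρ) → B ρ = B τ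

/-- `BSD(E/K) = BSD(E, Ind_{K/ℚ} 1)` for every number field `K`, and `Ш(E/K)` is finite. -/
def C1 : Prop :=
  ∀ (K : IntermediateField ℚ Qbar) [FiniteDimensional ℚ K],
    ((BSDQuotient E K : ℝ) : ℂ) = B (ArtinRep.ind K) ∧ Finite (Sha (E.baseChange K))

/-- `BSD(E, ρ ⊕ τ) = BSD(E, ρ) BSD(E, τ)`. -/
def C2 : Prop :=
  ∀ ρ τ : ArtinRep, B (ρ.sum τ) = B ρ * B τ

/-- If `⟨ρ, E(K)_ℂ⟩ = 0`, then `BSD(E, ρ) ∈ ℚ(ρ)ˣ` and `BSD(E, ρ^s) = BSD(E, ρ)^s` for all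
`s ∈ Gal(ℚ(ρ)/ℚ)`, where `ρ^s` is any Artin representation with character `s ∘ Tr ρ`. -/
def C5 : Prop :=
  ∀ (K : IntermediateField ℚ Qbar) [FiniteDimensional ℚ K] [IsGalois ℚ K] (V : Type)
    [AddCommGroup V] [Module ℂ V] [FiniteDimensional ℂ V] (ρ : Representation ℂ (K ≃ₐ[ℚ] K) V),
    multiplicity E K ρ = 0 →
    ∃ b : charField ρ, (b : ℂ) = B (ArtinRep.inflate K ρ) ∧
      ∀ (s : charField ρ ≃ₐ[ℚ] charField ρ) (τ : ArtinRep),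
        (∀ g : GQ, τ.ρ.character g = s (charValue ρ (AlgEquiv.restrictNormalHom K g))) →
        (B τ : ℂ) = s b

/-- If `⟨ρ, E(K)_ℂ⟩ = 0` and `ρ` is a non-trivial one-dimensional character of order `d`, then
`BSD(E, ρ) ∈ ℤ[ζ_d]`, provided that the conductors of `E` and `ρ` are coprime or `E` is semistable
without non-trivial isogenies. Primitive Dirichlet characters are identified with one-dimensional
Artin representations over `ℚ`. -/
def C6 : Prop :=
  ∀ (K : IntermediateField ℚ Qbar) [FiniteDimensional ℚ K] [IsGalois ℚ K] (V : Type)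
    [AddCommGroup V] [Module ℂ V] [FiniteDimensional ℂ V] (ρ : Representation ℂ (K ≃ₐ[ℚ] K) V),
    multiplicity E K ρ = 0 → Module.finrank ℂ V = 1 → ¬ ρ.IsTrivial → IntegralityCondition E K ρ →
    (B (ArtinRep.inflate K ρ) : ℂ) ∈ cyclotomicInt (orderOf ρ.character)

/-- There are invariants `BSD(E, ρ) ∈ ℂˣ` with the properties C1, C2 and C5. -/
def Conjecture125 : Prop :=
  ∃ B : ArtinRep → ℂˣ, IsoInvariant B ∧ C1 E B ∧ C2 B ∧ C5 E B

/-- There are invariants `BSD(E, ρ) ∈ ℂˣ` with the properties C1, C2, C5 and C6. -/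
def Conjecture1256 : Prop :=
  ∃ B : ArtinRep → ℂˣ, IsoInvariant B ∧ C1 E B ∧ C2 B ∧ C5 E B ∧ C6 E B

/-- The subfield `F^H` of `F`, where `H` is a subgroup of `G ≃ Gal(F/ℚ)`. -/
def fixedSubfield {G : Type*} [Group G] {F : IntermediateField ℚ Qbar} (e : (F ≃ₐ[ℚ] F) ≃* G)
    (H : Subgroup G) : IntermediateField ℚ Qbar :=
  IntermediateField.lift (IntermediateField.fixedField (H.comap e.toMonoidHom))

instance finiteDimensional_fixedSubfield {G : Type*} [Group G] {F : IntermediateField ℚ Qbar}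
    [FiniteDimensional ℚ F] (e : (F ≃ₐ[ℚ] F) ≃* G) (H : Subgroup G) :
    FiniteDimensional ℚ (fixedSubfield e H) :=
  Module.Finite.equiv (IntermediateField.liftAlgEquiv
    (IntermediateField.fixedField (H.comap e.toMonoidHom))).toLinearEquiv

end Conjecture

end BSDTwist

end

/-!
By Artin formalism (isomorphism invariance and multiplicativity), `BSD(E, ·)` depends only on
characters and turns every `ℤ`-linear relation between characters of Artin representations into a
multiplicative relation. The given relation, inflated along `G_ℚ → Gal(F/ℚ) ≃ G`, becomes
`∏ᵢ BSD(E/F^{Hᵢ}) / ∏ⱼ BSD(E/F^{H'ⱼ}) = (∏ₛ BSD(E, ρˢ))ᵐ`, the left-hand side being rewritten with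
(C1). Since `BSD(E/F) ≠ 0`, the group `E(F) ⊗ ℂ` is finite-dimensional, so `⟨ρ, E(F)_ℂ⟩` is a
natural number. If it vanishes, then by (C5) the `BSD(E, ρˢ)` are the Galois conjugates of
`x = BSD(E, ρ) ∈ ℚ(ρ)`, whose product is the norm of `x`; and (C6) places `x` in `ℤ[ζ_d]`.
-/

namespace BSDTwist

section DirectSums

variable {k G V W : Type*} [Field k] [Group G] [AddCommGroup V] [Module k V] [AddCommGroup W]
  [Module k W] {ρ : Representation k G V} {σ : Representation k G W}

theorem character_prod [FiniteDimensional k V] [FiniteDimensional k W] (ρ : Representation k G V)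
    (σ : Representation k G W) : (ρ.prod σ).character = ρ.character + σ.character :=
  funext fun _ => LinearMap.trace_prodMap' _ _

/-- The isomorphism `ρ ⊕ τ ≃ σ ⊕ υ` assembled from isomorphisms `ρ ≃ σ` and `τ ≃ υ`. -/
noncomputable def prodCongr {X Y : Type*} [AddCommGroup X] [Module k X] [AddCommGroup Y]
    [Module k Y] {τ : Representation k G X} {υ : Representation k G Y} (φ : ρ.Equiv σ)
    (ψ : τ.Equiv υ) : (ρ.prod τ).Equiv (σ.prod υ) :=
  .mk (φ.toLinearEquiv.prodCongr ψ.toLinearEquiv) fun g => LinearMap.ext fun x =>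
    Prod.ext (φ.toIntertwiningMap.isIntertwining _ _ g x.1)
      (ψ.toIntertwiningMap.isIntertwining _ _ g x.2)

/-- The isomorphism of the direct sum `p ⊕ q` of two complementary subrepresentations with the
whole representation. -/
noncomputable def prodEquivOfIsCompl {p q : Subrepresentation ρ} (h : IsCompl p q) :
    (p.toRepresentation.prod q.toRepresentation).Equiv ρ :=
  .mk (Submodule.prodEquivOfIsCompl p.toSubmodule q.toSubmodule <| .of_eq
      (by rw [← Subrepresentation.toSubmodule_inf, h.inf_eq_bot]; rfl)
      (by rw [← Subrepresentation.toSubmodule_sup, h.sup_eq_top]; rfl)) fun g =>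
    LinearMap.ext fun x => (map_add (ρ g) (x.1 : V) (x.2 : V)).symm

/-- The restriction of an intertwining map to a complement of its kernel, as an isomorphism onto
its range. -/
noncomputable def complKerEquivRange (f : ρ.IntertwiningMap σ) {q : Subrepresentation ρ}
    (h : IsCompl f.ker q) : q.toRepresentation.Equiv f.range.toRepresentation :=
  .mk (LinearEquiv.ofBijective
    ((f.toLinearMap.domRestrict q.toSubmodule).codRestrict f.range.toSubmodule fun x => ⟨x.1, rfl⟩)
    (by
      refine ⟨(injective_iff_map_eq_zero _).mpr fun x hx => ?_, ?_⟩
      · have hx' : (x : V) ∈ f.ker ⊓ q := ⟨congrArg Subtype.val hx, x.2⟩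
        rw [h.inf_eq_bot] at hx'
        exact Subtype.ext hx'
      · rintro ⟨_, v, rfl⟩
        obtain ⟨⟨a, b⟩, rfl⟩ := (prodEquivOfIsCompl h).toLinearEquiv.surjective v
        have hab : f (a.1 + b.1) = f b.1 := by
          rw [map_add, show f a.1 = 0 from a.2, zero_add]
        exact ⟨b, Subtype.ext hab.symm⟩))
    fun g => LinearMap.ext fun x => Subtype.ext (f.isIntertwining _ _ g x.1)

theorem nonempty_ker_prod_range_equiv [ρ.IsSemisimpleRepresentation] (f : ρ.IntertwiningMap σ) :
    Nonempty ((f.ker.toRepresentation.prod f.range.toRepresentation).Equiv ρ) := by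
  obtain ⟨q, hq⟩ := exists_isCompl f.ker
  exact ⟨(prodCongr (.refl _) (complKerEquivRange f hq).symm).trans (prodEquivOfIsCompl hq)⟩

end DirectSums

section CharactersDetermine

variable {k G V W : Type*} [Field k] [CharZero k] [Group G] [AddCommGroup V] [Module k V]
  [FiniteDimensional k V] [AddCommGroup W] [Module k W] [FiniteDimensional k W]

theorem finrank_eq_of_character_eq {ρ : Representation k G V} {σ : Representation k G W}
    (h : ρ.character = σ.character) : Module.finrank k V = Module.finrank k W := by
  simpa only [Representation.char_one, Nat.cast_inj] using congrFun h 1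

variable [Finite G]

theorem exists_intertwiningMap_ne_zero_of_character_eq [Nontrivial V] {ρ : Representation k G V}
    {σ : Representation k G W} (h : ρ.character = σ.character) :
    ∃ f : ρ.IntertwiningMap σ, f ≠ 0 := by
  have := Fintype.ofFinite G
  have : Invertible (Nat.card G : k) := invertibleOfNonzero (mod_cast Nat.card_pos.ne')
  -- The dimension of `Hom(ρ, σ)` is the inner product of the characters.
  have hdim : Module.finrank k (ρ.IntertwiningMap ρ) = Module.finrank k (ρ.IntertwiningMap σ) := by
    have hσ := Representation.card_inv_mul_sum_char_mul_char_eq_finrank ρ σ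
    rw [← h, Representation.card_inv_mul_sum_char_mul_char_eq_finrank ρ ρ] at hσ
    exact_mod_cast hσ
  obtain ⟨v, hv⟩ := exists_ne (0 : V)
  have : Nontrivial (ρ.IntertwiningMap ρ) :=
    ⟨.id ρ, 0, fun hid => hv (DFunLike.congr_fun hid v)⟩
  have : Nontrivial (ρ.IntertwiningMap σ) :=
    Module.nontrivial_of_finrank_pos (R := k) (hdim ▸ Module.finrank_pos)
  exact exists_ne 0

theorem nonempty_equiv_of_character_eq (ρ : Representation k G V) (σ : Representation k G W)
    (h : ρ.character = σ.character) : Nonempty (ρ.Equiv σ) := by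
  induction hn : Module.finrank k V using Nat.strong_induction_on generalizing V W with
  | _ n ih =>
    have : NeZero (Nat.card G : k) := ⟨mod_cast Nat.card_pos.ne'⟩
    rcases subsingleton_or_nontrivial V with _ | _
    · exact ⟨.mk (.ofFinrankEq V W (finrank_eq_of_character_eq h)) fun g =>
        LinearMap.ext fun x => by rw [Subsingleton.elim x 0, map_zero, map_zero]⟩
    obtain ⟨f, hf⟩ := exists_intertwiningMap_ne_zero_of_character_eq h
    obtain ⟨φ⟩ := nonempty_ker_prod_range_equiv f
    obtain ⟨r, hr⟩ := exists_isCompl f.range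
    let ψ := prodEquivOfIsCompl hr.symm
    have hchar : f.ker.toRepresentation.character = r.toRepresentation.character := by
      have hsum := (Representation.char_iso φ).trans (h.trans (Representation.char_iso ψ).symm)
      rw [character_prod, character_prod] at hsum
      exact add_right_cancel hsum
    have hlt : Module.finrank k f.ker.toSubmodule < n := by
      refine hn ▸ Submodule.finrank_lt fun htop => hf ?_
      ext v
      exact LinearMap.congr_fun (LinearMap.ker_eq_top.mp htop) v
    obtain ⟨χ⟩ := ih _ hlt _ _ hchar rfl
    exact ⟨φ.symm.trans ((prodCongr χ (.refl _)).trans ψ)⟩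

end CharactersDetermine

section GaloisConjugates

theorem exists_ringHom_comp_algebraMap_eq {A S M : Type*} [CommRing A] [IsDomain A] [Field S]
    [Algebra A S] [FaithfulSMul A S] [Algebra.IsAlgebraic A S] [Field M] [IsAlgClosed M]
    {f : A →+* M} (hf : Function.Injective f) : ∃ g : S →+* M, g.comp (algebraMap A S) = f := by
  algebraize [f]
  have : FaithfulSMul A M := (faithfulSMul_iff_algebraMap_injective A M).mpr hf
  exact ⟨(IsAlgClosed.lift : S →ₐ[A] M), (IsAlgClosed.lift : S →ₐ[A] M).comp_algebraMap⟩

theorem exists_ringHom_extends {L M : Type*} [Field L] [Field M] [Algebra L M] [IsAlgClosed M]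
    (s : L →+* L) : ∃ f : M →+* M, ∀ x, f (algebraMap L M x) = algebraMap L M (s x) := by
  obtain ⟨ι, x, hx⟩ := exists_isTranscendenceBasis' L M
  have := hx.isAlgebraic
  -- Extend `s` to the polynomial ring on a transcendence basis by fixing the basis.
  let φ : Algebra.adjoin L (Set.range x) →+* M :=
    ((MvPolynomial.aeval x : MvPolynomial ι L →ₐ[L] M) : MvPolynomial ι L →+* M).comp
      ((MvPolynomial.map s).comp
        (hx.1.aevalEquiv.symm : Algebra.adjoin L (Set.range x) →+* MvPolynomial ι L))
  have hφ : Function.Injective φ :=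
    (show Function.Injective (MvPolynomial.aeval x : MvPolynomial ι L →ₐ[L] M) from hx.1).comp
      ((MvPolynomial.map_injective s s.injective).comp hx.1.aevalEquiv.symm.injective)
  obtain ⟨f, hf⟩ := exists_ringHom_comp_algebraMap_eq (S := M) hφ
  refine ⟨f, fun a => (RingHom.congr_fun hf (algebraMap L _ a)).trans ?_⟩
  simp [φ]

variable {k k' G V : Type*} [Field k] [Field k'] [Group G] [AddCommGroup V] [Module k V] {n : ℕ}

/-- The representation over `k'` whose matrices are the images under `f : k →+* k'` of the matrices
of `ρ` in the basis `b`. -/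
noncomputable def mapMatrix (b : Module.Basis (Fin n) k V) (f : k →+* k')
    (ρ : Representation k G V) : Representation k' G (Fin n → k') :=
  (Matrix.toLinAlgEquiv' : Matrix (Fin n) (Fin n) k' ≃ₐ[k'] _).toMonoidHom.comp <|
    f.mapMatrix.toMonoidHom.comp <| (LinearMap.toMatrixAlgEquiv b).toMonoidHom.comp ρ

theorem character_mapMatrix (b : Module.Basis (Fin n) k V) (f : k →+* k')
    (ρ : Representation k G V) (g : G) : (mapMatrix b f ρ).character g = f (ρ.character g) := by
  change LinearMap.trace k' _ (Matrix.toLin' (f.mapMatrix (LinearMap.toMatrix b b (ρ g)))) = _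
  rw [Matrix.trace_toLin'_eq, Representation.character, LinearMap.trace_eq_matrix_trace k b]
  simp [Matrix.trace]

end GaloisConjugates

section CharField

theorem trace_mem_of_pow_eq_one {k V S : Type*} [Field k] [IsAlgClosed k] [AddCommGroup V]
    [Module k V] [FiniteDimensional k V] [SetLike S k] [AddSubmonoidClass S k] {s : S} {n : ℕ}
    (hs : ∀ μ : k, μ ^ n = 1 → μ ∈ s) {f : Module.End k V} (hf : f ^ n = 1) :
    LinearMap.trace k V f ∈ s := by
  rw [Module.End.trace_eq_sum_roots_charpoly_of_splits (IsAlgClosed.splits _)]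
  refine multiset_sum_mem _ fun μ hμ => hs μ ?_
  have hμ' : f.HasEigenvalue μ :=
    (Module.End.hasEigenvalue_iff_isRoot_charpoly _ _).mpr (Polynomial.isRoot_of_mem_roots hμ)
  obtain ⟨v, hv⟩ := hμ'.exists_hasEigenvector
  refine smul_left_injective k hv.2 ?_
  change μ ^ n • v = (1 : k) • v
  rw [← hv.pow_apply, hf, Module.End.one_apply, one_smul]

/-- The field `ℚ(ζₙ) ⊆ ℂ`, in the form of the adjunction of all `n`-th roots of unity for which
Mathlib knows that it is a cyclotomic extension. -/
noncomputable abbrev cyclotomicSubfield (n : ℕ) : IntermediateField ℚ ℂ :=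
  IntermediateField.adjoin ℚ {x : ℂ | ∃ m ∈ ({n} : Set ℕ), m ≠ 0 ∧ x ^ m = 1}

instance isCyclotomicExtension_cyclotomicSubfield (n : ℕ) :
    IsCyclotomicExtension {n} ℚ (cyclotomicSubfield n) :=
  IntermediateField.isCyclotomicExtension_adjoin_of_exists_isPrimitiveRoot _ ℚ ℂ
    fun m _ hm => ⟨_, Complex.isPrimitiveRoot_exp m hm⟩

variable {G V : Type*} [Group G] [AddCommGroup V] [Module ℂ V] [FiniteDimensional ℂ V]

theorem charField_le_cyclotomicSubfield [Finite G] (ρ : Representation ℂ G V) :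
    charField ρ ≤ cyclotomicSubfield (Nat.card G) := by
  rw [IntermediateField.adjoin_le_iff]
  rintro _ ⟨g, rfl⟩
  refine trace_mem_of_pow_eq_one (n := Nat.card G) (fun μ hμ => ?_)
    (by rw [← map_pow, pow_card_eq_one', map_one])
  exact IntermediateField.subset_adjoin _ _ ⟨_, rfl, Nat.card_pos.ne', hμ⟩

instance finiteDimensional_charField [Finite G] (ρ : Representation ℂ G V) :
    FiniteDimensional ℚ (charField ρ) :=
  have := IsCyclotomicExtension.finiteDimensional {Nat.card G} ℚ (cyclotomicSubfield (Nat.card G))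
  .of_injective (IntermediateField.inclusion (charField_le_cyclotomicSubfield ρ)).toLinearMap
    (IntermediateField.inclusion_injective (charField_le_cyclotomicSubfield ρ))

instance isGalois_charField [Finite G] (ρ : Representation ℂ G V) : IsGalois ℚ (charField ρ) :=
  have := IsCyclotomicExtension.isAbelianGalois {Nat.card G} ℚ (cyclotomicSubfield (Nat.card G))
  (IsAbelianGalois.of_algHom
    (IntermediateField.inclusion (charField_le_cyclotomicSubfield ρ))).toIsGalois

theorem ratCast_norm_eq_prod_conjugates [Finite G] (ρ : Representation ℂ G V)
    [Fintype (charField ρ ≃ₐ[ℚ] charField ρ)] (x : charField ρ) :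
    ((Algebra.norm ℚ x : ℚ) : ℂ) = ∏ s : charField ρ ≃ₐ[ℚ] charField ρ, (s x : ℂ) := by
  have h := congrArg (charField ρ).val (Algebra.norm_eq_prod_automorphisms ℚ x)
  rw [AlgHom.commutes, eq_ratCast, map_prod] at h
  simp only [IntermediateField.coe_val] at h
  convert h

/-- The Galois conjugate of `ρ` by an automorphism `s` of `ℚ(ρ)`: an extension of `s` to `ℂ`, chosen
arbitrarily, is applied to the matrices of `ρ`. -/
noncomputable def galoisConjugate (ρ : Representation ℂ G V)
    (s : charField ρ ≃ₐ[ℚ] charField ρ) :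
    Representation ℂ G (Fin (Module.finrank ℂ V) → ℂ) :=
  mapMatrix (Module.finBasis ℂ V)
    (exists_ringHom_extends (M := ℂ) (s : charField ρ →+* charField ρ)).choose ρ

theorem character_galoisConjugate (ρ : Representation ℂ G V)
    (s : charField ρ ≃ₐ[ℚ] charField ρ) (g : G) :
    (galoisConjugate ρ s).character g = s (charValue ρ g) :=
  (character_mapMatrix _ _ ρ g).trans
    ((exists_ringHom_extends (M := ℂ) (s : charField ρ →+* charField ρ)).choose_spec
      (charValue ρ g))

end CharField

section Induction

variable {Γ G : Type*} [Group Γ] [Group G]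

/-- The bijection `Γ ⧸ φ⁻¹(H) ≃ G ⧸ H` induced by a surjection `φ : Γ → G`. -/
noncomputable def cosetsComapEquiv (φ : Γ →* G) (hφ : Function.Surjective φ) (H : Subgroup G) :
    Γ ⧸ H.comap φ ≃ G ⧸ H :=
  .ofBijective (Quotient.map' φ fun a b h => by
      rw [QuotientGroup.leftRel_apply] at h ⊢
      simpa using h) <| by
    refine ⟨fun x y hxy => ?_, fun x => ?_⟩
    · induction x using QuotientGroup.induction_on with | H a =>
      induction y using QuotientGroup.induction_on with | H b =>
      have hab : (φ a : G ⧸ H) = φ b := hxy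
      rw [QuotientGroup.eq] at hab ⊢
      simpa using hab
    · induction x using QuotientGroup.induction_on with | H g =>
      obtain ⟨a, rfl⟩ := hφ g
      exact ⟨(a : Γ ⧸ H.comap φ), rfl⟩

theorem cosetsComapEquiv_smul {φ : Γ →* G} (hφ : Function.Surjective φ) (H : Subgroup G) (γ : Γ)
    (x : Γ ⧸ H.comap φ) :
    cosetsComapEquiv φ hφ H (γ • x) = φ γ • cosetsComapEquiv φ hφ H x := by
  induction x using QuotientGroup.induction_on with | H a =>
  exact congrArg (QuotientGroup.mk (s := H)) (map_mul φ γ a)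

theorem nonempty_indOne_comap_equiv {φ : Γ →* G} (hφ : Function.Surjective φ) (H : Subgroup G) :
    Nonempty ((indOne (H.comap φ)).Equiv ((indOne H).comp φ)) := by
  refine ⟨.mk ((MonoidAlgebra.coeffLinearEquiv ℂ).trans ((Finsupp.domLCongr
    (cosetsComapEquiv φ hφ H)).trans (MonoidAlgebra.coeffLinearEquiv ℂ).symm)) fun γ => ?_⟩
  ext x
  simp [cosetsComapEquiv_smul]

variable {F : IntermediateField ℚ Qbar}

/-- The projection `G_ℚ → Gal(F/ℚ) ≃ G`. -/
noncomputable abbrev galProj [IsGalois ℚ F] (e : (F ≃ₐ[ℚ] F) ≃* G) : GQ →* G :=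
  e.toMonoidHom.comp (AlgEquiv.restrictNormalHom F)

theorem galProj_surjective [IsGalois ℚ F] (e : (F ≃ₐ[ℚ] F) ≃* G) :
    Function.Surjective (galProj e) :=
  e.surjective.comp (AlgEquiv.restrictNormalHom_surjective Qbar)

variable [FiniteDimensional ℚ F] [IsGalois ℚ F] (e : (F ≃ₐ[ℚ] F) ≃* G) (H : Subgroup G)

theorem fixingSubgroup_fixedSubfield :
    (fixedSubfield e H).fixingSubgroup = H.comap (galProj e) :=
  (IntermediateField.map_fixingSubgroup Qbar _).trans <| by
    rw [IntermediateField.fixingSubgroup_fixedField, Subgroup.comap_comap]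

theorem character_ind_fixedSubfield (σ : GQ) :
    (ArtinRep.ind (fixedSubfield e H)).ρ.character σ = (indOne H).character (galProj e σ) := by
  obtain ⟨φ⟩ := nonempty_indOne_comap_equiv (galProj_surjective e) H
  change (indOne (fixedSubfield e H).fixingSubgroup).character σ = _
  rw [fixingSubgroup_fixedSubfield, Representation.char_iso φ]
  rfl

end Induction

section ArtinFormalism

namespace ArtinRep

theorem nonempty_equiv_of_character_eq (ρ τ : ArtinRep) (h : ρ.ρ.character = τ.ρ.character) :
    Nonempty (ρ.ρ.Equiv τ.ρ) := by
  obtain ⟨K, _, _, hK⟩ := ρ.factors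
  obtain ⟨L, _, _, hL⟩ := τ.factors
  let N : Subgroup GQ := (AlgEquiv.restrictNormalHom (F := ℚ) (K₁ := Qbar)
    (K ⊔ L : IntermediateField ℚ Qbar)).ker
  have hN : N = (K ⊔ L).fixingSubgroup := IntermediateField.restrictNormalHom_ker _
  have : Finite (GQ ⧸ N) := by rw [hN]; infer_instance
  have hρ : ∀ σ ∈ N, ρ.ρ σ = 1 := fun σ hσ =>
    hK σ (IntermediateField.fixingSubgroup_antitone le_sup_left (hN ▸ hσ))
  have hτ : ∀ σ ∈ N, τ.ρ σ = 1 := fun σ hσ =>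
    hL σ (IntermediateField.fixingSubgroup_antitone le_sup_right (hN ▸ hσ))
  let ρ' : Representation ℂ (GQ ⧸ N) ρ.V := QuotientGroup.lift N ρ.ρ hρ
  let τ' : Representation ℂ (GQ ⧸ N) τ.V := QuotientGroup.lift N τ.ρ hτ
  obtain ⟨φ⟩ := BSDTwist.nonempty_equiv_of_character_eq ρ' τ' <| funext fun q => by
    induction q using QuotientGroup.induction_on with | H σ => exact congrFun h σ
  exact ⟨.mk φ.toLinearEquiv fun σ => φ.toIntertwiningMap.isIntertwining' (σ : GQ ⧸ N)⟩

/-- The zero Artin representation, the neutral element of `ArtinRep.sum`. -/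
noncomputable def zero : ArtinRep where
  V := PUnit
  ρ := Representation.trivial ℂ GQ PUnit
  factors := ⟨⊥, inferInstance, inferInstance, fun _ _ => rfl⟩

theorem character_zero : zero.ρ.character = 0 :=
  funext fun σ => by
    rw [Representation.character, show zero.ρ σ = 0 from LinearMap.ext fun _ => rfl, map_zero,
      Pi.zero_apply]

theorem character_sum (ρ τ : ArtinRep) :
    (ρ.sum τ).ρ.character = ρ.ρ.character + τ.ρ.character :=
  character_prod ρ.ρ τ.ρ

end ArtinRep

variable {B : ArtinRep → ℂˣ} (hiso : IsoInvariant B) (hC2 : C2 B)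
include hiso

theorem IsoInvariant.eq_of_character_eq {ρ τ : ArtinRep} (h : ρ.ρ.character = τ.ρ.character) :
    B ρ = B τ :=
  hiso ρ τ (ρ.nonempty_equiv_of_character_eq τ h)

include hC2

theorem apply_zero_eq_one : B .zero = 1 := by
  have h : B (.sum .zero .zero) = B .zero := hiso.eq_of_character_eq <| by
    rw [ArtinRep.character_sum, ArtinRep.character_zero, add_zero]
  rwa [hC2, mul_eq_left] at h

theorem exists_character_eq_sum_and_apply_eq_prod {ι : Type*} (f : ι → ArtinRep) (s : Finset ι) :
    ∃ T : ArtinRep, T.ρ.character = ∑ i ∈ s, (f i).ρ.character ∧ B T = ∏ i ∈ s, B (f i) := by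
  classical
  induction s using Finset.induction_on with
  | empty =>
    exact ⟨.zero, ArtinRep.character_zero.trans Finset.sum_empty.symm,
      (apply_zero_eq_one hiso hC2).trans Finset.prod_empty.symm⟩
  | insert a s ha ih =>
    obtain ⟨T, hT, hB⟩ := ih
    exact ⟨(f a).sum T, by rw [ArtinRep.character_sum, hT, Finset.sum_insert ha],
      by rw [hC2, hB, Finset.prod_insert ha]⟩

theorem prod_pow_eq_prod_pow_of_sum_character_eq {ι : Type*} [Fintype ι] (f : ι → ArtinRep)
    (a b : ι → ℕ) (h : ∑ i, a i • (f i).ρ.character = ∑ i, b i • (f i).ρ.character) :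
    ∏ i, B (f i) ^ a i = ∏ i, B (f i) ^ b i := by
  have hsum (n : ι → ℕ) : ∃ T : ArtinRep, T.ρ.character = ∑ i, n i • (f i).ρ.character ∧
      B T = ∏ i, B (f i) ^ n i := by
    obtain ⟨T, hT, hB⟩ := exists_character_eq_sum_and_apply_eq_prod hiso hC2
      (fun p : Σ i, Fin (n i) => f p.1) .univ
    refine ⟨T, hT.trans ?_, hB.trans ?_⟩
    · rw [Fintype.sum_sigma]
      exact Finset.sum_congr rfl fun i _ => Fin.sum_const (n i) (f i).ρ.character
    · rw [Fintype.prod_sigma]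
      exact Finset.prod_congr rfl fun i _ => Fin.prod_const (n i) (B (f i))
  obtain ⟨T, hT, hB⟩ := hsum a
  obtain ⟨T', hT', hB'⟩ := hsum b
  rw [← hB, ← hB', hiso.eq_of_character_eq (hT.trans (h.trans hT'.symm))]

theorem prod_zpow_eq_one_of_sum_character_eq_zero {ι : Type*} [Fintype ι] (f : ι → ArtinRep)
    (a : ι → ℤ) (h : ∑ i, a i • (f i).ρ.character = 0) : ∏ i, B (f i) ^ a i = 1 := by
  have hprod := prod_pow_eq_prod_pow_of_sum_character_eq hiso hC2 f (fun i => (a i).toNat)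
    (fun i => (-a i).toNat) <| by
      rw [← sub_eq_zero, ← Finset.sum_sub_distrib, ← h]
      refine Finset.sum_congr rfl fun i _ => ?_
      rw [← natCast_zsmul, ← natCast_zsmul, ← sub_smul, Int.toNat_sub_toNat_neg]
  rw [← div_eq_one, ← Finset.prod_div_distrib] at hprod
  rw [← hprod]
  refine Finset.prod_congr rfl fun i _ => ?_
  rw [← zpow_natCast, ← zpow_natCast, div_eq_mul_inv, ← zpow_sub, Int.toNat_sub_toNat_neg]

end ArtinFormalism

section MordellWeil

open scoped TensorProduct

theorem finite_tensorProduct_of_closure_sup_torsion_eq_top {k M ι : Type*} [Field k] [CharZero k]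
    [AddCommGroup M] [Finite ι] {P : ι → M}
    (h : AddSubgroup.closure (Set.range P) ⊔ AddCommGroup.torsion M = ⊤) :
    Module.Finite k (k ⊗[ℤ] M) := by
  let S : Submodule k (k ⊗[ℤ] M) := Submodule.span k (Set.range fun i => 1 ⊗ₜ[ℤ] P i)
  let φ : M →+ k ⊗[ℤ] M := (TensorProduct.mk ℤ k M 1).toAddMonoidHom
  have hclosure : AddSubgroup.closure (Set.range P) ≤ S.toAddSubgroup.comap φ := by
    rw [AddSubgroup.closure_le]
    rintro _ ⟨i, rfl⟩
    exact Submodule.subset_span ⟨i, rfl⟩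
  have htorsion : AddCommGroup.torsion M ≤ S.toAddSubgroup.comap φ := fun t ht => by
    obtain ⟨m, hm, hmt⟩ := isOfFinAddOrder_iff_nsmul_eq_zero.mp ht
    have hmφ : (m : k) • φ t = 0 := by rw [Nat.cast_smul_eq_nsmul, ← map_nsmul, hmt, map_zero]
    rw [AddSubgroup.mem_comap, (smul_eq_zero.mp hmφ).resolve_left (mod_cast hm.ne')]
    exact S.zero_mem
  have hφ (Q : M) : φ Q ∈ S := h.ge.trans (sup_le hclosure htorsion) (AddSubgroup.mem_top Q)
  have hS : S = ⊤ := by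
    rw [← top_le_iff, ← Submodule.baseChange_top, Submodule.baseChange_eq_span, Submodule.span_le]
    rintro _ ⟨Q, -, rfl⟩
    exact hφ Q
  exact ⟨hS ▸ Submodule.fg_span (Set.finite_range _)⟩

variable {E : WeierstrassCurve ℚ} {B : ArtinRep → ℂˣ}

-- The regulator has the junk value `0` when no Mordell--Weil basis exists.
open Classical in
theorem finiteDimensional_of_BSDQuotient_ne_zero {K : Type*} [Field K] [NumberField K]
    [hK : Algebra ℚ K] (h : BSDQuotient E K ≠ 0) :
    FiniteDimensional ℂ (ℂ ⊗[ℤ] (E.baseChange K).toAffine.Point) := by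
  obtain rfl : hK = DivisionRing.toRatAlgebra := Subsingleton.elim _ _
  have hbasis : ∃ (n : ℕ) (P : Fin n → (E.baseChange K).toAffine.Point),
      IsMordellWeilBasis (E.baseChange K) P := by
    contrapose! h
    rw [BSDQuotient, regulator, dif_neg (by simpa using h), zero_mul, zero_mul, zero_div]
  obtain ⟨n, P, hP⟩ := hbasis
  exact finite_tensorProduct_of_closure_sup_torsion_eq_top hP.2

theorem C1.BSDQuotient_ne_zero (hC1 : C1 E B) (K : IntermediateField ℚ Qbar)
    [FiniteDimensional ℚ K] : BSDQuotient E K ≠ 0 := fun h0 =>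
  (B (.ind K)).ne_zero <| by rw [← (hC1 K).1, h0, Complex.ofReal_zero]

theorem charInner_character_eq_finrank {G V W : Type*} [Group G] [Fintype G] [AddCommGroup V]
    [Module ℂ V] [FiniteDimensional ℂ V] [AddCommGroup W] [Module ℂ W] [FiniteDimensional ℂ W]
    (ρ : Representation ℂ G V) (σ : Representation ℂ G W) :
    charInner ρ.character σ.character = Module.finrank ℂ (σ.IntertwiningMap ρ) := by
  have : Invertible (Nat.card G : ℂ) := invertibleOfNonzero (mod_cast Nat.card_pos.ne')
  rw [charInner, ← Nat.card_eq_fintype_card]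
  exact Representation.card_inv_mul_sum_char_mul_char_eq_finrank σ ρ

theorem C1.multiplicity_pos_or_eq_zero (hC1 : C1 E B) (K : IntermediateField ℚ Qbar)
    [FiniteDimensional ℚ K] {V : Type*} [AddCommGroup V] [Module ℂ V] [FiniteDimensional ℂ V]
    (ρ : Representation ℂ (K ≃ₐ[ℚ] K) V) :
    0 < multiplicity E K ρ ∨ multiplicity E K ρ = 0 := by
  have := finiteDimensional_of_BSDQuotient_ne_zero (hC1.BSDQuotient_ne_zero K)
  rw [multiplicity, charInner_character_eq_finrank, Nat.cast_pos, Nat.cast_eq_zero]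
  exact (Nat.eq_zero_or_pos _).symm

end MordellWeil

section Conjugates

variable {G : Type*} [Group G] {V : Type} [AddCommGroup V] [Module ℂ V] [FiniteDimensional ℂ V]
  {ρ : Representation ℂ G V} {E : WeierstrassCurve ℚ} {B : ArtinRep → ℂˣ}
  {F : IntermediateField ℚ Qbar} [FiniteDimensional ℚ F] [IsGalois ℚ F]

/-- The Galois conjugate of `ρ` by an automorphism `s` of `ℚ(ρ)`, as an Artin representation through
`G ≃ Gal(F/ℚ)`. -/
noncomputable def ArtinRep.conjugate (e : (F ≃ₐ[ℚ] F) ≃* G) (ρ : Representation ℂ G V)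
    (s : charField ρ ≃ₐ[ℚ] charField ρ) : ArtinRep :=
  .inflate F ((galoisConjugate ρ s).comp e.toMonoidHom)

theorem ArtinRep.character_conjugate (e : (F ≃ₐ[ℚ] F) ≃* G) (ρ : Representation ℂ G V)
    (s : charField ρ ≃ₐ[ℚ] charField ρ) (σ : GQ) :
    (conjugate e ρ s).ρ.character σ = s (charValue ρ (galProj e σ)) :=
  character_galoisConjugate ρ s (galProj e σ)

omit [FiniteDimensional ℂ V] in
theorem charField_comp_mulEquiv {Γ : Type*} [Group Γ] (e : Γ ≃* G) (ρ : Representation ℂ G V) :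
    charField (ρ.comp e.toMonoidHom) = charField ρ :=
  congrArg (IntermediateField.adjoin ℚ) (e.surjective.range_comp ρ.character)

theorem C5.exists_apply_conjugate_eq (hC5 : C5 E B) (e : (F ≃ₐ[ℚ] F) ≃* G)
    (h0 : multiplicity E F (ρ.comp e.toMonoidHom) = 0) :
    ∃ x : charField ρ, (x : ℂ) = B (.inflate F (ρ.comp e.toMonoidHom)) ∧
      ∀ s : charField ρ ≃ₐ[ℚ] charField ρ, (B (.conjugate e ρ s) : ℂ) = s x := by
  obtain ⟨b, hb, hs⟩ := hC5 F V (ρ.comp e.toMonoidHom) h0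
  obtain ⟨φ, hφ⟩ : ∃ φ : charField (ρ.comp e.toMonoidHom) ≃ₐ[ℚ] charField ρ,
      ∀ y, (φ y : ℂ) = y := by
    rw [charField_comp_mulEquiv]
    exact ⟨.refl, fun _ => rfl⟩
  have hφ_symm (y : charField ρ) : (φ.symm y : ℂ) = y := by rw [← hφ, φ.apply_symm_apply]
  have hφ_charValue (g : F ≃ₐ[ℚ] F) :
      φ (charValue (ρ.comp e.toMonoidHom) g) = charValue ρ (e g) := Subtype.ext (hφ _)
  refine ⟨φ b, (hφ b).trans hb, fun s => ?_⟩
  rw [hs (φ.trans (s.trans φ.symm)) (.conjugate e ρ s) fun σ => ?_]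
  · exact hφ_symm _
  · rw [AlgEquiv.trans_apply, AlgEquiv.trans_apply, hφ_symm, hφ_charValue,
      ArtinRep.character_conjugate]
    rfl

variable {ι κ : Type*} [Fintype ι] [Fintype κ]

theorem prod_apply_ind_div_eq_prod_conjugate_zpow (hiso : IsoInvariant B) (hC2 : C2 B)
    (e : (F ≃ₐ[ℚ] F) ≃* G) [Fintype (charField ρ ≃ₐ[ℚ] charField ρ)]
    (m : ℤ) (H : ι → Subgroup G) (H' : κ → Subgroup G)
    (hrel : ∀ g : G, (m : ℂ) * ∑ s : charField ρ ≃ₐ[ℚ] charField ρ, (s (charValue ρ g) : ℂ) =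
      ∑ i, (indOne (H i)).character g - ∑ j, (indOne (H' j)).character g) :
    (∏ i, B (.ind (fixedSubfield e (H i)))) / ∏ j, B (.ind (fixedSubfield e (H' j))) =
      (∏ s, B (.conjugate e ρ s)) ^ m := by
  let f : (charField ρ ≃ₐ[ℚ] charField ρ) ⊕ ι ⊕ κ → ArtinRep := Sum.elim (.conjugate e ρ) <|
    Sum.elim (fun i => .ind (fixedSubfield e (H i))) fun j => .ind (fixedSubfield e (H' j))
  have hf (σ : GQ) (a) : (f a).ρ.character σ =
      Sum.elim (fun s => (s (charValue ρ (galProj e σ)) : ℂ))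
        (Sum.elim (fun i => (indOne (H i)).character (galProj e σ))
          fun j => (indOne (H' j)).character (galProj e σ)) a := by
    rcases a with s | i | j
    · exact ArtinRep.character_conjugate e ρ s σ
    · exact character_ind_fixedSubfield e (H i) σ
    · exact character_ind_fixedSubfield e (H' j) σ
  have hprod := prod_zpow_eq_one_of_sum_character_eq_zero hiso hC2 f
    (Sum.elim (fun _ => m) (Sum.elim (fun _ => -1) fun _ => 1)) <| funext fun σ => by
      simp only [Finset.sum_apply, Pi.smul_apply, Pi.zero_apply, hf, Fintype.sum_sum_type,
        Sum.elim_inl, Sum.elim_inr, neg_smul, one_smul, Finset.sum_neg_distrib, ← Finset.smul_sum]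
      rw [zsmul_eq_mul, hrel]
      ring
  simp only [f, Fintype.prod_sum_type, Sum.elim_inl, Sum.elim_inr, zpow_neg_one, zpow_one,
    Finset.prod_zpow, Finset.prod_inv_distrib] at hprod
  rw [eq_inv_of_mul_eq_one_left hprod, mul_inv, inv_inv, div_eq_mul_inv]

omit [IsGalois ℚ F] in
theorem C1.ofReal_prod_BSDQuotient (hC1 : C1 E B) (e : (F ≃ₐ[ℚ] F) ≃* G) (H : ι → Subgroup G) :
    ((∏ i, BSDQuotient E (fixedSubfield e (H i)) : ℝ) : ℂ) =
      ((∏ i, B (.ind (fixedSubfield e (H i))) : ℂˣ) : ℂ) := by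
  rw [Units.coe_prod, Complex.ofReal_prod]
  exact Finset.prod_congr rfl fun i _ => (hC1 _).1

theorem prod_BSDQuotient_div_eq_norm_zpow (hiso : IsoInvariant B) (hC1 : C1 E B) (hC2 : C2 B)
    (e : (F ≃ₐ[ℚ] F) ≃* G) (x : charField ρ)
    (hx : ∀ s : charField ρ ≃ₐ[ℚ] charField ρ, (B (.conjugate e ρ s) : ℂ) = s x)
    (m : ℤ) (H : ι → Subgroup G) (H' : κ → Subgroup G)
    (hrel : ∀ g : G, (m : ℂ) * ∑ᶠ s : charField ρ ≃ₐ[ℚ] charField ρ, (s (charValue ρ g) : ℂ) =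
      ∑ i, (indOne (H i)).character g - ∑ j, (indOne (H' j)).character g) :
    (∏ i, BSDQuotient E (fixedSubfield e (H i))) /
      (∏ j, BSDQuotient E (fixedSubfield e (H' j))) = ((Algebra.norm ℚ x : ℚ) : ℝ) ^ m := by
  have : Finite G := .of_equiv _ e.toEquiv
  have : Fintype (charField ρ ≃ₐ[ℚ] charField ρ) := .ofFinite _
  have hnorm : ((Algebra.norm ℚ x : ℚ) : ℂ) = (∏ s, B (.conjugate e ρ s) : ℂˣ) := by
    rw [ratCast_norm_eq_prod_conjugates, Units.coe_prod]
    exact Finset.prod_congr rfl fun s _ => (hx s).symm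
  apply Complex.ofReal_injective
  rw [Complex.ofReal_div, Complex.ofReal_zpow, Complex.ofReal_ratCast, hnorm,
    hC1.ofReal_prod_BSDQuotient, hC1.ofReal_prod_BSDQuotient, ← Units.val_div_eq_div_val,
    ← Units.val_zpow_eq_zpow_val]
  simp only [finsum_eq_sum_of_fintype] at hrel
  rw [prod_apply_ind_div_eq_prod_conjugate_zpow hiso hC2 e m H H' hrel]

end Conjugates

section Integrality

theorem cyclotomicInt_le_of_dvd {n d : ℕ} (hd : d ≠ 0) (h : n ∣ d) :
    cyclotomicInt n ≤ cyclotomicInt d := by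
  obtain ⟨c, rfl⟩ := h
  have hc : (c : ℂ) ≠ 0 := Nat.cast_ne_zero.mpr (right_ne_zero_of_mul hd)
  have hpow : Complex.exp (2 * Real.pi * Complex.I / n) =
      Complex.exp (2 * Real.pi * Complex.I / (n * c : ℕ)) ^ c := by
    rw [← Complex.exp_nat_mul, Nat.cast_mul]
    field_simp
  refine Algebra.adjoin_singleton_le ?_
  rw [hpow]
  exact pow_mem (Algebra.self_mem_adjoin_singleton ℤ _) c

theorem trace_mul_of_finrank_eq_one {k V : Type*} [Field k] [AddCommGroup V] [Module k V]
    (h1 : Module.finrank k V = 1) (f g : Module.End k V) :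
    LinearMap.trace k V (f * g) = LinearMap.trace k V f * LinearMap.trace k V g := by
  obtain ⟨a, rfl, -⟩ := f.existsUnique_eq_smul_id_of_finrank_eq_one h1
  obtain ⟨b, rfl, -⟩ := g.existsUnique_eq_smul_id_of_finrank_eq_one h1
  have : FiniteDimensional k V := Module.finite_of_finrank_eq_succ h1
  simp [h1, Module.End.mul_eq_comp, mul_comm]

theorem orderOf_character_dvd_exponent {k G V : Type*} [Field k] [Group G] [AddCommGroup V]
    [Module k V] (ρ : Representation k G V) (h1 : Module.finrank k V = 1) :
    orderOf ρ.character ∣ Monoid.exponent G := by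
  have : FiniteDimensional k V := Module.finite_of_finrank_eq_succ h1
  let χ : G →* k :=
    { toFun := ρ.character
      map_one' := by rw [Representation.char_one, h1, Nat.cast_one]
      map_mul' g h := by
        simp only [Representation.character, map_mul, trace_mul_of_finrank_eq_one h1] }
  refine orderOf_dvd_of_pow_eq_one <| funext fun g => ?_
  calc χ g ^ Monoid.exponent G = χ (g ^ Monoid.exponent G) := (map_pow χ g _).symm
    _ = 1 := by rw [Monoid.pow_exponent_eq_one, map_one]

variable {G : Type*} [Group G] {V : Type} [AddCommGroup V] [Module ℂ V] [FiniteDimensional ℂ V]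
  {ρ : Representation ℂ G V} {E : WeierstrassCurve ℚ} {B : ArtinRep → ℂˣ}
  {F : IntermediateField ℚ Qbar} [FiniteDimensional ℚ F] [IsGalois ℚ F]

theorem C6.apply_mem_cyclotomicInt_exponent (hC6 : C6 E B) (e : (F ≃ₐ[ℚ] F) ≃* G)
    (h0 : multiplicity E F (ρ.comp e.toMonoidHom) = 0) (h1 : Module.finrank ℂ V = 1)
    (htriv : ¬ ρ.IsTrivial) (hint : IntegralityCondition E F (ρ.comp e.toMonoidHom)) :
    (B (.inflate F (ρ.comp e.toMonoidHom)) : ℂ) ∈ cyclotomicInt (Monoid.exponent G) := by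
  have htriv' : ¬ Representation.IsTrivial (ρ.comp e.toMonoidHom) := fun h =>
    htriv ⟨e.surjective.forall.mpr h.out⟩
  rw [← Monoid.exponent_eq_of_mulEquiv e]
  exact cyclotomicInt_le_of_dvd Monoid.exponent_ne_zero_of_finite
    (orderOf_character_dvd_exponent _ h1) (hC6 F V (ρ.comp e.toMonoidHom) h0 h1 htriv' hint)

end Integrality

end BSDTwist

open BSDTwist in
theorem mainTheorem4_general {G : Type*} [Group G]
    {V : Type} [AddCommGroup V] [Module ℂ V] [FiniteDimensional ℂ V]
    (ρ : Representation ℂ G V) {ι κ : Type*} [Fintype ι] [Fintype κ]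
    (m : ℤ) (H : ι → Subgroup G) (H' : κ → Subgroup G)
    (hrel : ∀ g : G,
      (m : ℂ) * ∑ᶠ s : charField ρ ≃ₐ[ℚ] charField ρ, (s (charValue ρ g) : ℂ) =
        ∑ i, (indOne (H i)).character g - ∑ j, (indOne (H' j)).character g)
    (E : WeierstrassCurve ℚ) [E.IsElliptic]
    (F : IntermediateField ℚ Qbar) [FiniteDimensional ℚ F] [IsGalois ℚ F]
    (e : (F ≃ₐ[ℚ] F) ≃* G) :
    (Conjecture125 E → 0 < multiplicity E F (ρ.comp e.toMonoidHom) ∨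
      ∃ x : charField ρ,
        (∏ i, BSDQuotient E (fixedSubfield e (H i))) /
          (∏ j, BSDQuotient E (fixedSubfield e (H' j))) = ((Algebra.norm ℚ x : ℚ) : ℝ) ^ m) ∧
    (Conjecture1256 E → ¬ ρ.IsTrivial → Module.finrank ℂ V = 1 →
      IntegralityCondition E F (ρ.comp e.toMonoidHom) →
      0 < multiplicity E F (ρ.comp e.toMonoidHom) ∨
      ∃ x : charField ρ, (x : ℂ) ∈ cyclotomicInt (Monoid.exponent G) ∧
        (∏ i, BSDQuotient E (fixedSubfield e (H i))) /
          (∏ j, BSDQuotient E (fixedSubfield e (H' j))) = ((Algebra.norm ℚ x : ℚ) : ℝ) ^ m) := by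
  constructor
  · rintro ⟨B, hiso, hC1, hC2, hC5⟩
    refine (hC1.multiplicity_pos_or_eq_zero F _).imp_right fun h0 => ?_
    obtain ⟨x, -, hx⟩ := hC5.exists_apply_conjugate_eq e h0
    exact ⟨x, prod_BSDQuotient_div_eq_norm_zpow hiso hC1 hC2 e x hx m H H' hrel⟩
  · rintro ⟨B, hiso, hC1, hC2, hC5, hC6⟩ htriv h1 hint
    refine (hC1.multiplicity_pos_or_eq_zero F _).imp_right fun h0 => ?_
    obtain ⟨x, hxB, hx⟩ := hC5.exists_apply_conjugate_eq e h0
    exact ⟨x, hxB ▸ hC6.apply_mem_cyclotomicInt_exponent e h0 h1 htriv hint,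
      prod_BSDQuotient_div_eq_norm_zpow hiso hC1 hC2 e x hx m H H' hrel⟩

theorem mainTheorem4 {G : Type*} [Group G] [Finite G]
    {V : Type} [AddCommGroup V] [Module ℂ V] [FiniteDimensional ℂ V]
    (ρ : Representation ℂ G V) (hρ : ρ.IsIrreducible)
    {ι κ : Type*} [Fintype ι] [Fintype κ]
    (m : ℤ) (H : ι → Subgroup G) (H' : κ → Subgroup G)
    (hrel : ∀ g : G,
      (m : ℂ) * ∑ᶠ s : BSDTwist.charField ρ ≃ₐ[ℚ] BSDTwist.charField ρ,
          (s (BSDTwist.charValue ρ g) : ℂ) =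
        ∑ i, (BSDTwist.indOne (H i)).character g - ∑ j, (BSDTwist.indOne (H' j)).character g)
    (E : WeierstrassCurve ℚ) [E.IsElliptic]
    (F : IntermediateField ℚ BSDTwist.Qbar) [FiniteDimensional ℚ F] [IsGalois ℚ F]
    (e : (F ≃ₐ[ℚ] F) ≃* G) :
    (BSDTwist.Conjecture125 E →
      0 < BSDTwist.multiplicity E F (ρ.comp e.toMonoidHom) ∨
      ∃ x : BSDTwist.charField ρ,
        (∏ i, BSDTwist.BSDQuotient E (BSDTwist.fixedSubfield e (H i))) /
          (∏ j, BSDTwist.BSDQuotient E (BSDTwist.fixedSubfield e (H' j))) = ((Algebra.norm ℚ x : ℚ) : ℝ) ^ m) ∧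
    (BSDTwist.Conjecture1256 E → ¬ ρ.IsTrivial → (∀ a b : G, a * b = b * a) →
      BSDTwist.IntegralityCondition E F (ρ.comp e.toMonoidHom) →
      0 < BSDTwist.multiplicity E F (ρ.comp e.toMonoidHom) ∨
      ∃ x : BSDTwist.charField ρ, (x : ℂ) ∈ BSDTwist.cyclotomicInt (Monoid.exponent G) ∧
        (∏ i, BSDTwist.BSDQuotient E (BSDTwist.fixedSubfield e (H i))) /
          (∏ j, BSDTwist.BSDQuotient E (BSDTwist.fixedSubfield e (H' j))) = ((Algebra.norm ℚ x : ℚ) : ℝ) ^ m) := by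
  obtain ⟨hnorm, hint⟩ := mainTheorem4_general ρ m H H' hrel E F e
  exact ⟨hnorm, fun hB htriv hcomm =>
    have : IsMulCommutative G := ⟨⟨hcomm⟩⟩
    hint hB htriv (Representation.IsIrreducible.finrank_eq_one_of_isMulCommutative ρ)⟩
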